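/- Let $k$ be a field of characteristic zero, and let $\mathrm{Aut}(k^2)$ be the group of polynomial automorphisms of the affine plane $k^2$. Let $A = \mathrm{GL}_2(k) \ltimes k^2$ be its subgroup of affine automorphisms, and let $$B = \{(x,y) \mapsto (ax + P(y),\, by + c) \;:\; a,b,c \in k,\ ab \neq 0,\ P \in k[y]\}$$ be its subgroup of elementary automorphisms. The group $\mathrm{Aut}(k^2)$ is the amalgamated product of $A$ and $B$ along $A \cap B$; let $T$ be the associated Bass–Serre tree, whose vertices are the left cosets $fA$ and $fB$ and whose edges are the left cosets $f(A \cap B)$, joining $fA$ to $fB$, for $f \in \mathrm{Aut}(k^2)$. The group $\mathrm{Aut}(k^2)$ acts on $T$ by left translation, and $T$ is endowed with the length metric for which every edge is isometric to $[0,1]$. The action of a group $G$ by isometries on a metric space $X$ is called acylindrical if for every $d \geq 0$ there exist $R_d > 0$ and $N_d > 0$ such that for all $x, y \in X$ with $\mathrm{dist}(x,y) > R_d$ the set $$\{ g \in G \;:\; \mathrm{dist}(x, gx) \leq d,\ \mathrm{dist}(y, gy) \leq d \}$$ contains at most $N_d$ elements. Then the action of $\mathrm{Aut}(k^2)$ on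 $T$ is acylindrical if and only if $k$ contains only finitely many roots of unity. -/

import Mathlib

namespace SimpleGraph

variable {V : Type*}

/-- A point of the geometric realization of a graph, given by its barycentric coordinates:
either a vertex, or a point `(1 - t) u + t v` of an edge `{u, v}`. -/
@[ext]
structure Realization (Γ : SimpleGraph V) where
  weight : V → ℝ
  nonneg : ∀ v, 0 ≤ weight v
  mem_simplex :
    (∃ v, weight v = 1 ∧ ∀ w, w ≠ v → weight w = 0) ∨
    (∃ u v, Γ.Adj u v ∧ weight u + weight v = 1 ∧ ∀ w, w ≠ u → w ≠ v → weight w = 0)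

namespace Realization

variable {Γ : SimpleGraph V}

/-- The point `p` lies on the closed segment spanned by the vertices `u` and `v`. -/
def OnSegment (p : Γ.Realization) (u v : V) : Prop :=
  ∀ w, w ≠ u → w ≠ v → p.weight w = 0

/-- `JoinedBy p q ℓ`: there is a piecewise linear path of length `ℓ` from `p` to `q`, each of
whose pieces is contained in a closed edge, every edge being isometric to `[0, 1]`. -/
inductive JoinedBy : Γ.Realization → Γ.Realization → NNReal → Prop
  | refl (p : Γ.Realization) : JoinedBy p p 0
  | step {p q r : Γ.Realization} {ℓ : NNReal} {u v : V} (hpq : JoinedBy p q ℓ)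
      (huv : Γ.Adj u v) (hq : q.OnSegment u v) (hr : r.OnSegment u v) :
      JoinedBy p r (ℓ + nndist (q.weight u) (r.weight u))

theorem weight_add_weight (p : Γ.Realization) {u v : V} (huv : u ≠ v)
    (hp : p.OnSegment u v) : p.weight u + p.weight v = 1 := by
  rcases p.mem_simplex with ⟨a, ha, h⟩ | ⟨a, b, hab, hs, h⟩
  · by_cases hau : a = u
    · subst hau
      rw [ha, h v huv.symm, add_zero]
    · by_cases hav : a = v
      · subst hav
        rw [ha, h u huv, zero_add]
      · have := hp a hau hav
        linarith
  · have hne := hab.ne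
    by_cases hau : a = u
    · by_cases hbv : b = v
      · rw [← hau, ← hbv, hs]
      · have h1 := hp b (fun e => hne (hau.trans e.symm)) hbv
        have h2 := h v (fun e => huv (hau.symm.trans e.symm)) (Ne.symm hbv)
        rw [← hau]
        linarith
    · by_cases hav : a = v
      · by_cases hbu : b = u
        · rw [← hav, ← hbu, add_comm, hs]
        · have h1 := hp b hbu (fun e => hne (hav.trans e.symm))
          have h2 := h u (Ne.symm hau) (Ne.symm hbu)
          rw [← hav]
          linarith
      · have h1 := hp a hau hav
        by_cases hbu : b = u
        · have h2 := h v (Ne.symm hav) (fun e => huv (hbu.symm.trans e.symm))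
          rw [← hbu]
          linarith
        · by_cases hbv : b = v
          · have h2 := h u (Ne.symm hau) (Ne.symm hbu)
            rw [← hbv]
            linarith
          · have h2 := hp b hbu hbv
            linarith

theorem JoinedBy.trans {p q r : Γ.Realization} {ℓ m : NNReal} (h₁ : JoinedBy p q ℓ)
    (h₂ : JoinedBy q r m) : JoinedBy p r (ℓ + m) := by
  induction h₂ with
  | refl => simpa using h₁
  | step _ huv hq hr ih =>
    rw [← add_assoc]
    exact JoinedBy.step ih huv hq hr

theorem JoinedBy.symm {p q : Γ.Realization} {ℓ : NNReal} (h : JoinedBy p q ℓ) :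
    JoinedBy q p ℓ := by
  induction h with
  | refl => exact JoinedBy.refl _
  | step _ huv hq hr ih =>
    have := (JoinedBy.step (JoinedBy.refl _) huv hr hq).trans ih
    rwa [zero_add, nndist_comm, add_comm] at this

theorem JoinedBy.dist_weight_le {p q : Γ.Realization} {ℓ : NNReal} (h : JoinedBy p q ℓ) (w : V) :
    nndist (p.weight w) (q.weight w) ≤ ℓ := by
  induction h with
  | refl => simp
  | @step q r ℓ u v _ huv hq hr ih =>
    refine (nndist_triangle _ (q.weight w) _).trans (add_le_add ih ?_)
    have h1 := q.weight_add_weight huv.ne hq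
    have h2 := r.weight_add_weight huv.ne hr
    by_cases hwu : w = u
    · rw [hwu]
    by_cases hwv : w = v
    · subst hwv
      rw [← NNReal.coe_le_coe, coe_nndist, coe_nndist, Real.dist_eq, Real.dist_eq,
        show q.weight w - r.weight w = -(q.weight u - r.weight u) by linarith, abs_neg]
    · rw [hq w hwu hwv, hr w hwu hwv]
      simp

/-- The length metric on the realization: the distance between two points is the infimum of the
lengths of the paths between them (it is infinite exactly when there is no path). -/
noncomputable instance : EMetricSpace Γ.Realization where
  edist p q := ⨅ (ℓ : NNReal) (_ : JoinedBy p q ℓ), (ℓ : ENNReal)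
  edist_self p := le_antisymm (iInf₂_le_of_le 0 (JoinedBy.refl p) (by simp)) bot_le
  edist_comm p q := le_antisymm
    (le_iInf₂ fun ℓ h => iInf₂_le ℓ h.symm) (le_iInf₂ fun ℓ h => iInf₂_le ℓ h.symm)
  edist_triangle p q r := by
    simp only [ENNReal.iInf_add, ENNReal.add_iInf]
    refine le_iInf₂ fun ℓ h₁ => le_iInf₂ fun m h₂ => ?_
    exact iInf₂_le_of_le (m + ℓ) (h₂.trans h₁) (by simp)
  eq_of_edist_eq_zero {p q} h := by
    ext w
    have h1 : EDist.edist (p.weight w) (q.weight w) ≤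
        ⨅ (ℓ : NNReal) (_ : JoinedBy p q ℓ), (ℓ : ENNReal) := by
      refine le_iInf₂ fun ℓ hℓ => ?_
      rw [edist_nndist]
      exact_mod_cast hℓ.dist_weight_le w
    exact edist_le_zero.mp (h1.trans h.le)

end Realization

end SimpleGraph

namespace BassSerre

variable {G : Type*} [Group G]

/-- The Bass–Serre graph of a group `G` with respect to two subgroups `A` and `B`: its vertices
are the left cosets `f A` and `f B`, and its edges are the left cosets `f (A ∩ B)`, which join
`f A` to `f B`. (An edge is determined by its endpoints, so this is a simple graph.) -/
def graph (A B : Subgroup G) : SimpleGraph ((G ⧸ A) ⊕ (G ⧸ B)) :=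
  SimpleGraph.fromRel fun x y => ∃ f : G, x = Sum.inl (f : G ⧸ A) ∧ y = Sum.inr (f : G ⧸ B)

theorem graph_adj_smul {A B : Subgroup G} (g : G) {x y : (G ⧸ A) ⊕ (G ⧸ B)}
    (h : (graph A B).Adj x y) : (graph A B).Adj (g • x) (g • y) := by
  simp only [graph, SimpleGraph.fromRel_adj] at h ⊢
  refine ⟨fun e => h.1 (smul_left_cancel g e), ?_⟩
  rcases h.2 with ⟨f, rfl, rfl⟩ | ⟨f, rfl, rfl⟩
  · exact Or.inl ⟨g * f, rfl, rfl⟩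
  · exact Or.inr ⟨g * f, rfl, rfl⟩

/-- The metric space underlying the Bass–Serre tree: the realization of the graph, with edges of
length one. -/
abbrev Tree (A B : Subgroup G) := (graph A B).Realization

/-- The action of `G` on the Bass–Serre tree extending left translation of cosets. -/
instance (A B : Subgroup G) : MulAction G (Tree A B) where
  smul g p :=
    { weight := fun v => p.weight (g⁻¹ • v)
      nonneg := fun v => p.nonneg _
      mem_simplex := by
        rcases p.mem_simplex with ⟨v, hv, h⟩ | ⟨u, v, huv, hs, h⟩
        · refine Or.inl ⟨g • v, by simpa using hv, fun w hw => h _ ?_⟩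
          rintro rfl
          exact hw (by simp)
        · refine Or.inr ⟨g • u, g • v, graph_adj_smul g huv, by simpa using hs,
            fun w hu hv => h _ ?_ ?_⟩
          · rintro rfl
            exact hu (by simp)
          · rintro rfl
            exact hv (by simp) }
  one_smul p := by
    ext v
    change p.weight ((1 : G)⁻¹ • v) = p.weight v
    simp
  mul_smul g h p := by
    ext v
    change p.weight ((g * h)⁻¹ • v) = p.weight (h⁻¹ • g⁻¹ • v)
    rw [mul_inv_rev, mul_smul]

instance (A B : Subgroup G) : IsIsometricSMul G (Tree A B) where
  isometry_smul g := by
    have key : ∀ (h : G) {p q : Tree A B} {ℓ : NNReal}, p.JoinedBy q ℓ →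
        (h • p).JoinedBy (h • q) ℓ := by
      intro h p q ℓ hpq
      have hs : ∀ {p : Tree A B} {u v}, p.OnSegment u v → (h • p).OnSegment (h • u) (h • v) := by
        intro p u v hp w hu hv
        refine hp (h⁻¹ • w) ?_ ?_
        · rintro rfl
          exact hu (by simp)
        · rintro rfl
          exact hv (by simp)
      have hw : ∀ (p : Tree A B) v, (h • p).weight (h • v) = p.weight v := by
        intro p v
        change p.weight (h⁻¹ • h • v) = p.weight v
        rw [inv_smul_smul]
      induction hpq with
      | refl => exact .refl _
      | @step q r ℓ u v _ huv hq hr ih =>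
        have := SimpleGraph.Realization.JoinedBy.step ih (graph_adj_smul h huv) (hs hq) (hs hr)
        rwa [hw, hw] at this
    intro p q
    refine le_antisymm (le_iInf₂ fun ℓ h => iInf₂_le ℓ (key g h))
      (le_iInf₂ fun ℓ h => iInf₂_le ℓ ?_)
    simpa using key g⁻¹ h

end BassSerre

/-- Acylindricity of the action (by isometries) of a group `G` on a metric space `X`: for all `d` there are
`R, N > 0` such that for all `x, y` at distance `> R`, at most `N` elements of `G` move both `x`
and `y` by at most `d`. Distances are allowed to be infinite here, and the condition concerns the
pairs `x, y` at finite distance; in a metric space (a connected graph) these are all the pairs. -/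
def IsAcylindrical (G X : Type*) [Group G] [EMetricSpace X] [MulAction G X]
    [IsIsometricSMul G X] : Prop :=
  ∀ d : NNReal, ∃ R : NNReal, 0 < R ∧ ∃ N : ℕ, 0 < N ∧ ∀ x y : X,
    (R : ENNReal) < edist x y → edist x y < ⊤ →
      {g : G | edist x (g • x) ≤ d ∧ edist y (g • y) ≤ d}.encard ≤ N

section PlaneAutomorphisms

variable (k : Type*) [Field k]

/-- A map `k² → k²` both of whose components are polynomials in the two coordinates. -/
def IsPolynomialMap {k : Type*} [Field k] (f : k × k → k × k) : Prop :=
  ∃ P Q : MvPolynomial (Fin 2) k, ∀ p : k × k,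
    f p = (MvPolynomial.eval ![p.1, p.2] P, MvPolynomial.eval ![p.1, p.2] Q)

theorem IsPolynomialMap.comp {k : Type*} [Field k] {f g : k × k → k × k} (hf : IsPolynomialMap f)
    (hg : IsPolynomialMap g) : IsPolynomialMap (f ∘ g) := by
  obtain ⟨P, Q, hPQ⟩ := hf
  obtain ⟨R, S, hRS⟩ := hg
  have key : ∀ (T : MvPolynomial (Fin 2) k) (p : k × k),
      MvPolynomial.eval ![(g p).1, (g p).2] T =
        MvPolynomial.eval ![p.1, p.2] (MvPolynomial.bind₁ ![R, S] T) := by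
    intro T p
    rw [MvPolynomial.eval, MvPolynomial.eval, MvPolynomial.eval₂Hom_bind₁]
    congr 2
    funext i
    rw [hRS]
    fin_cases i <;> rfl
  refine ⟨MvPolynomial.bind₁ ![R, S] P, MvPolynomial.bind₁ ![R, S] Q, fun p => ?_⟩
  rw [Function.comp_apply, hPQ, key, key]

/-- The group `Aut(k²)` of polynomial automorphisms of the plane, under composition: bijections of
`k²` that are polynomial maps and whose inverses are polynomial maps. (Over an infinite field, in
particular in characteristic zero, polynomials are determined by the maps they define.) -/
def PlaneAut : Subgroup (Equiv.Perm (k × k)) where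
  carrier := {f | IsPolynomialMap (f : k × k → k × k) ∧
    IsPolynomialMap (f.symm : k × k → k × k)}
  one_mem' := by
    have : IsPolynomialMap (id : k × k → k × k) :=
      ⟨MvPolynomial.X 0, MvPolynomial.X 1, fun p => by simp⟩
    exact ⟨this, this⟩
  mul_mem' := fun {f g} hf hg => ⟨hf.1.comp hg.1, hg.2.comp hf.2⟩
  inv_mem' := fun {f} hf => ⟨hf.2, hf.1⟩

/-- The subgroup `A = GL₂(k) ⋉ k²` of affine automorphisms. -/
def affineAut : Subgroup (PlaneAut k) where
  carrier := {f | ∃ φ : (k × k) ≃ᵃ[k] (k × k), f.1 = φ.toEquiv}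
  one_mem' := ⟨AffineEquiv.refl k (k × k), rfl⟩
  mul_mem' := by
    rintro f g ⟨φ, hφ⟩ ⟨ψ, hψ⟩
    exact ⟨ψ.trans φ, by rw [Subgroup.coe_mul, hφ, hψ]; rfl⟩
  inv_mem' := by
    rintro f ⟨φ, hφ⟩
    exact ⟨φ.symm, by rw [Subgroup.coe_inv, hφ]; rfl⟩

/-- The subgroup `B` of elementary automorphisms `(x, y) ↦ (a x + P(y), b y + c)`, `a b ≠ 0`. -/
def elementaryAut : Subgroup (PlaneAut k) where
  carrier := {f | ∃ (a b c : k) (P : Polynomial k), a * b ≠ 0 ∧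
    ∀ x y : k, f.1 (x, y) = (a * x + P.eval y, b * y + c)}
  one_mem' := ⟨1, 1, 0, 0, by simp, fun x y => by simp⟩
  mul_mem' := by
    rintro f g ⟨a, b, c, P, hab, hf⟩ ⟨a', b', c', P', hab', hg⟩
    refine ⟨a * a', b * b', b * c' + c,
      Polynomial.C a * P' + P.comp (Polynomial.C b' * Polynomial.X + Polynomial.C c'),
      ?_, fun x y => ?_⟩
    · rw [mul_mul_mul_comm]
      exact mul_ne_zero hab hab'
    · rw [Subgroup.coe_mul, Equiv.Perm.mul_apply, hg, hf]
      simp only [Polynomial.eval_add, Polynomial.eval_mul, Polynomial.eval_C,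
        Polynomial.eval_comp, Polynomial.eval_X, Prod.mk.injEq]
      constructor <;> ring
  inv_mem' := by
    rintro f ⟨a, b, c, P, hab, hf⟩
    have ha : a ≠ 0 := left_ne_zero_of_mul hab
    have hb : b ≠ 0 := right_ne_zero_of_mul hab
    refine ⟨a⁻¹, b⁻¹, -(b⁻¹ * c),
      -(Polynomial.C a⁻¹ * P.comp (Polynomial.C b⁻¹ * (Polynomial.X - Polynomial.C c))),
      mul_ne_zero (inv_ne_zero ha) (inv_ne_zero hb), fun x y => ?_⟩
    rw [Subgroup.coe_inv, Equiv.Perm.inv_eq_iff_eq, hf]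
    simp only [Polynomial.eval_neg, Polynomial.eval_mul, Polynomial.eval_C,
      Polynomial.eval_comp, Polynomial.eval_X, Polynomial.eval_sub, Prod.mk.injEq]
    have e : b⁻¹ * y + -(b⁻¹ * c) = b⁻¹ * (y - c) := by ring
    rw [e]
    constructor
    · field_simp
      ring
    · field_simp
      ring

end PlaneAutomorphisms

/-!
A group acting on a tree acts acylindrically as soon as the pointwise stabilizers of the segments
of some fixed length have bounded order (`BassSerre.isAcylindrical_of_encard_stabilizer_le`):
elements which move the ends of a long geodesic `p` by at most `d` map some vertices of `p` to two
prescribed interior vertices of `p`, with a bounded number of choices, and each choice is realized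
by at most a coset of the stabilizer of these two vertices.

The Bass–Serre graph of `Aut(k²)` has no cycle (`PlaneAut.isAcyclic_graph`). This is a ping-pong
argument on parametrized curves `t ↦ (F(t), G(t))`: an element of `B` outside `A` sends the
nonconstant curves with `deg F ≤ deg G` to curves with `deg F > deg G`, and an element of `A`
outside `B` does the opposite. That `A` and `B` generate `Aut(k²)`, i.e. the connectedness of the
graph, is not needed, because acylindricity only concerns pairs of points at finite distance.

Up to translation, a path with six edges centred at a coset of `A` is centred at `A` with middle
edges leading to `B` and `s B`, where `s` is the transposition of the coordinates. An element fixing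
these is a diagonal affine map `(x, y) ↦ (α x + β, δ y + c)`. Fixing the two edges which follow `B`
forces `α = δ ^ m` with `m ≥ 2` and determines `c` in terms of `α` and `δ`, by comparison of the two
leading coefficients in `α P(y) = P(δ y + h) + (affine)`; this is where characteristic zero enters
(`PlaneAut.exists_forall_eq_pow_of_conj_mem`). By symmetry `δ = α ^ m'`, and `β` is determined. So
`α` and `δ` are roots of unity, and the stabilizer has at most `|μ(k)|²` elements.

Conversely, for `ζ ^ r = 1` the homothety of ratio `ζ` commutes with the Hénon map
`(x, y) ↦ (y, x + y ^ (r + 1))`, so it fixes its axis: arbitrarily long segments are fixed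
by as many elements as there are `r`-th roots of unity in `k`
(`PlaneAut.exists_forall_encard_le_of_isAcylindrical`).
-/

/-! ### The length metric of a graph and walks -/

namespace SimpleGraph

variable {V : Type*} {Γ : SimpleGraph V}

namespace Realization

open Classical in
/-- The vertex `v`, as a point of the geometric realization. -/
noncomputable def ofVertex (Γ : SimpleGraph V) (v : V) : Γ.Realization where
  weight w := if w = v then 1 else 0
  nonneg w := by split_ifs <;> norm_num
  mem_simplex := Or.inl ⟨v, by simp, fun w hw => by simp [hw]⟩

@[simp]
theorem weight_ofVertex_self (v : V) : (ofVertex Γ v).weight v = 1 := by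
  simp [ofVertex]

theorem weight_ofVertex_of_ne {v w : V} (h : w ≠ v) : (ofVertex Γ v).weight w = 0 := by
  simp [ofVertex, h]

theorem onSegment_ofVertex_left (u v : V) : (ofVertex Γ u).OnSegment u v :=
  fun _ hu _ => weight_ofVertex_of_ne hu

theorem onSegment_ofVertex_right (u v : V) : (ofVertex Γ v).OnSegment u v :=
  fun _ _ hv => weight_ofVertex_of_ne hv

theorem JoinedBy.edist_le {p q : Γ.Realization} {ℓ : NNReal} (h : JoinedBy p q ℓ) :
    EDist.edist p q ≤ ℓ :=
  iInf₂_le ℓ h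

theorem edist_ofVertex_le_length {u v : V} (p : Γ.Walk u v) :
    EDist.edist (ofVertex Γ u) (ofVertex Γ v) ≤ p.length := by
  suffices h : JoinedBy (ofVertex Γ u) (ofVertex Γ v) p.length by
    simpa using h.edist_le
  induction p with
  | nil => simpa using JoinedBy.refl _
  | @cons u v w huv p ih =>
    have h := (JoinedBy.refl (ofVertex Γ u)).step huv
      (onSegment_ofVertex_left u v) (onSegment_ofVertex_right u v)
    have e : nndist ((ofVertex Γ u).weight u) ((ofVertex Γ v).weight u) = 1 := by
      rw [weight_ofVertex_self, weight_ofVertex_of_ne huv.ne]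
      ext
      simp
    rw [e, zero_add] at h
    have := h.trans ih
    rw [Walk.length_cons]
    push_cast
    rwa [add_comm]

/-- A path of length `ℓ` in the realization from the vertex `u` to a point `q` can be turned into
a walk in the graph from `u` to each vertex `v` of the simplex carrying `q`: the walk is no longer
than `ℓ` plus the distance from `q` to `v`. -/
theorem JoinedBy.exists_walk {u : V} {q : Γ.Realization} {ℓ : NNReal}
    (h : JoinedBy (ofVertex Γ u) q ℓ) {v : V} (hv : q.weight v ≠ 0) :
    ∃ p : Γ.Walk u v, (p.length : ℝ) ≤ ℓ + (1 - q.weight v) := by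
  generalize hp : ofVertex Γ u = p at h
  induction h generalizing v with
  | refl =>
    subst hp
    obtain rfl : v = u := by
      by_contra hne
      exact hv (weight_ofVertex_of_ne hne)
    exact ⟨.nil, by simp⟩
  | @step q r ℓ a b _ hab hq hr ih =>
    have hq1 := q.weight_add_weight hab.ne hq
    have hr1 := r.weight_add_weight hab.ne hr
    have key : ∀ a b, Γ.Adj a b → q.weight a + q.weight b = 1 →
        ∃ p : Γ.Walk u a, (p.length : ℝ) ≤
          (ℓ + nndist (q.weight a) (r.weight a) : NNReal) + (1 - r.weight a) := by
      intro a b hab hq1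
      have habs := neg_abs_le (q.weight a - r.weight a)
      by_cases h0 : q.weight a = 0
      · obtain ⟨p, hp⟩ := ih (v := b) (by rw [h0] at hq1; linarith)
        refine ⟨p.concat hab.symm, ?_⟩
        rw [Walk.length_concat]
        push_cast
        rw [Real.dist_eq]
        linarith
      · obtain ⟨p, hp⟩ := ih h0
        refine ⟨p, ?_⟩
        push_cast
        rw [Real.dist_eq]
        linarith
    by_cases hva : v = a
    · subst hva
      exact key v b hab hq1
    by_cases hvb : v = b
    · subst hvb
      obtain ⟨p, hp⟩ := key v a hab.symm (by rw [add_comm, hq1])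
      refine ⟨p, hp.trans_eq ?_⟩
      push_cast
      rw [Real.dist_eq, Real.dist_eq,
        show q.weight v - r.weight v = -(q.weight a - r.weight a) by linarith, abs_neg]
    · exact absurd (hr v hva hvb) hv

theorem exists_walk_length_lt {u v : V} {c : ENNReal}
    (h : EDist.edist (ofVertex Γ u) (ofVertex Γ v) < c) :
    ∃ p : Γ.Walk u v, (p.length : ENNReal) < c := by
  change (⨅ (ℓ : NNReal) (_ : JoinedBy (ofVertex Γ u) (ofVertex Γ v) ℓ), (ℓ : ENNReal)) < c at h
  simp only [iInf_lt_iff] at h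
  obtain ⟨ℓ, hℓ, hlt⟩ := h
  obtain ⟨p, hp⟩ := hℓ.exists_walk (v := v) (by simp)
  refine ⟨p, lt_of_le_of_lt ?_ hlt⟩
  rw [weight_ofVertex_self, sub_self, add_zero] at hp
  exact_mod_cast hp

theorem exists_edist_ofVertex_le_one (p : Γ.Realization) :
    ∃ v, EDist.edist p (ofVertex Γ v) ≤ 1 := by
  rcases p.mem_simplex with ⟨v, hv, h⟩ | ⟨u, v, huv, hs, h⟩
  · refine ⟨v, ?_⟩
    obtain rfl : p = ofVertex Γ v := by
      ext w
      by_cases hw : w = v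
      · rw [hw, hv, weight_ofVertex_self]
      · rw [h w hw, weight_ofVertex_of_ne hw]
    simp
  · refine ⟨u, ((JoinedBy.refl p).step huv h (onSegment_ofVertex_left u v)).edist_le.trans ?_⟩
    rw [zero_add, weight_ofVertex_self, ← ENNReal.coe_one, ENNReal.coe_le_coe,
      ← NNReal.coe_le_coe, coe_nndist, Real.dist_eq, abs_le]
    have := p.nonneg u
    have := p.nonneg v
    constructor <;> simp <;> linarith

end Realization

/-! ### Geodesics in forests -/

namespace IsAcyclic

theorem bypass_eq [DecidableEq V] (h : Γ.IsAcyclic) {u v : V} {p : Γ.Walk u v} (hp : p.IsPath)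
    (q : Γ.Walk u v) : q.bypass = p :=
  congrArg Subtype.val ((h.subsingleton_path u v).elim ⟨q.bypass, q.bypass_isPath⟩ ⟨p, hp⟩)

theorem length_le_of_isPath (h : Γ.IsAcyclic) {u v : V} {p : Γ.Walk u v} (hp : p.IsPath)
    (q : Γ.Walk u v) : p.length ≤ q.length := by
  classical
  rw [← h.bypass_eq hp q]
  exact q.length_bypass_le_length

theorem support_subset_of_isPath (h : Γ.IsAcyclic) {u v : V} {p : Γ.Walk u v} (hp : p.IsPath)
    (q : Γ.Walk u v) : p.support ⊆ q.support := by
  classical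
  rw [← h.bypass_eq hp q]
  exact q.support_bypass_subset_support

/-- In a forest, a sequence of adjacent vertices without backtracking is a geodesic. -/
theorem exists_isPath_of_forall_ne (h : Γ.IsAcyclic) (v : ℕ → V)
    (hadj : ∀ i, Γ.Adj (v i) (v (i + 1))) (hne : ∀ i, v i ≠ v (i + 2)) (n : ℕ) :
    ∃ p : Γ.Walk (v 0) (v n), p.IsPath ∧ p.length = n := by
  suffices H : ∃ p : Γ.Walk (v 0) (v (n + 1)), p.IsPath ∧ p.length = n + 1 ∧
      p.penultimate = v n by
    obtain ⟨p, hp, hl, hpen⟩ := H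
    have hd := hp.take n
    have e : p.getVert n = v n := by rw [← hpen, Walk.penultimate, hl, Nat.add_sub_cancel]
    exact ⟨(p.take n).copy rfl e, by simpa using hd, by simp [hl]⟩
  induction n with
  | zero => exact ⟨(Walk.nil).cons (hadj 0) |>.copy rfl rfl, by simp [(hadj 0).ne], by simp, rfl⟩
  | succ n ih =>
    obtain ⟨p, hp, hl, hpen⟩ := ih
    have hns : v (n + 2) ∉ p.support := by
      intro hs
      have := h.eq_penultimate_of_adj_end hp (hadj (n + 1)) hs
      exact hne n (hpen ▸ this.symm)
    exact ⟨p.concat (hadj (n + 1)), hp.concat hns _, by simp [hl], by simp⟩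

end IsAcyclic

end SimpleGraph

/-! ### A criterion for acylindricity on a Bass–Serre tree -/

namespace BassSerre

open SimpleGraph Realization

variable {G : Type*} [Group G] {A B : Subgroup G}

/-- Left translation by `g`, as an endomorphism of the Bass–Serre graph. -/
def translate (A B : Subgroup G) (g : G) : graph A B →g graph A B where
  toFun v := g • v
  map_rel' h := graph_adj_smul g h

theorem translate_injective (g : G) : Function.Injective (translate A B g) :=
  MulAction.injective g

theorem smul_ofVertex (g : G) (v : (G ⧸ A) ⊕ (G ⧸ B)) :
    g • ofVertex (graph A B) v = ofVertex (graph A B) (g • v) := by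
  ext w
  change (ofVertex (graph A B) v).weight (g⁻¹ • w) = _
  by_cases h : w = g • v
  · rw [h, inv_smul_smul, weight_ofVertex_self, weight_ofVertex_self]
  · rw [weight_ofVertex_of_ne h, weight_ofVertex_of_ne (by rwa [Ne, inv_smul_eq_iff])]

/-- If `g` moves the ends of the geodesic `p` by at most `D`, then `g • p` passes through each
vertex `p i` of `p` at distance more than `D` from both ends, and `p i` is the translate of one
of the first `i + D` vertices of `p`. -/
theorem exists_smul_getVert_eq (hΓ : (graph A B).IsAcyclic) {u v : (G ⧸ A) ⊕ (G ⧸ B)}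
    {p : (graph A B).Walk u v} (hp : p.IsPath) {D i : ℕ} (hi : D < i) (hi' : i + D < p.length)
    {g : G} (q : (graph A B).Walk u (g • u)) (hq : q.length ≤ D)
    (r : (graph A B).Walk v (g • v)) (hr : r.length ≤ D) :
    ∃ j, j ≤ i + D ∧ g • p.getVert j = p.getVert i := by
  classical
  let p' : (graph A B).Walk (g • u) (g • v) := p.map (translate A B g)
  have hp' : p'.IsPath := hp.map (translate_injective g)
  have h1 : (p.take i).IsPath := hp.take i
  have h2 : (p.drop i).IsPath := hp.drop i
  have hmem : p.getVert i ∈ (q.append (p'.append r.reverse)).support :=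
    hΓ.support_subset_of_isPath hp _ (p.getVert_mem_support i)
  rw [Walk.mem_support_append_iff, Walk.mem_support_append_iff] at hmem
  rcases hmem with hmem | hmem | hmem
  · -- `p i` is too far from `u` to lie on `q`
    have h3 := hΓ.length_le_of_isPath h1 (q.takeUntil _ hmem)
    have h4 := q.length_takeUntil_le_length hmem
    rw [Walk.take_length] at h3
    omega
  · obtain ⟨j, hj, hjl⟩ := Walk.mem_support_iff_exists_getVert.mp hmem
    have e : g • p.getVert j = p.getVert i := by
      rw [← hj]
      exact (Walk.getVert_map (translate A B g) p j).symm
    refine ⟨j, ?_, e⟩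
    have h3 := hΓ.length_le_of_isPath (hp'.take j)
      ((q.reverse.append (p.take i)).copy rfl hj.symm)
    have h4 : p'.length = p.length := Walk.length_map _ _
    rw [Walk.take_length, Walk.length_copy, Walk.length_append, Walk.length_reverse,
      Walk.take_length] at h3
    omega
  · -- `p i` is too far from `v` to lie on `r`
    rw [Walk.support_reverse, List.mem_reverse] at hmem
    have h3 := hΓ.length_le_of_isPath h2 (r.takeUntil _ hmem).reverse
    have h4 := r.length_takeUntil_le_length hmem
    rw [Walk.drop_length, Walk.length_reverse] at h3
    omega

/-- An action on a Bass–Serre tree is acylindrical as soon as the pointwise stabilizers of the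
segments of some fixed length have bounded order. -/
theorem isAcylindrical_of_encard_stabilizer_le (hΓ : (graph A B).IsAcyclic) (L N : ℕ)
    (h : ∀ (u v : (G ⧸ A) ⊕ (G ⧸ B)) (p : (graph A B).Walk u v), p.IsPath → p.length = L →
      {g : G | g • u = u ∧ g • v = v}.encard ≤ N) :
    IsAcylindrical G (Tree A B) := by
  intro d
  obtain ⟨D, hD⟩ : ∃ D : ℕ, (d : ENNReal) + 2 < D + 1 := by
    refine ⟨⌈d⌉₊ + 2, ?_⟩
    have h1 : (d : ENNReal) ≤ (⌈d⌉₊ : ℕ) := by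
      exact_mod_cast Nat.le_ceil d
    calc (d : ENNReal) + 2 ≤ (⌈d⌉₊ + 2 : ℕ) := by push_cast; gcongr
      _ < _ := by exact_mod_cast Nat.lt_succ_self _
  have hw : ∀ {x : Tree A B} {u}, EDist.edist x (ofVertex (graph A B) u) ≤ 1 → ∀ {g : G},
      EDist.edist x (g • x) ≤ d → ∃ q : (graph A B).Walk u (g • u), q.length ≤ D := by
    intro x u hu g hg
    have hlt : EDist.edist (ofVertex (graph A B) u) (ofVertex (graph A B) (g • u)) < D + 1 := by
      refine lt_of_le_of_lt ?_ hD
      calc _ ≤ EDist.edist (ofVertex (graph A B) u) x + EDist.edist x (g • x) +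
            EDist.edist (g • x) (g • ofVertex (graph A B) u) := by
              rw [smul_ofVertex]
              exact edist_triangle4 _ _ _ _
        _ ≤ 1 + d + 1 := by
              rw [edist_smul_left, edist_comm _ x]
              gcongr
        _ = d + 2 := by ring
    obtain ⟨q, hq⟩ := exists_walk_length_lt hlt
    have hq' : q.length < D + 1 := by exact_mod_cast hq
    exact ⟨q, Nat.lt_succ_iff.mp hq'⟩
  refine ⟨(3 * D + L + 5 : ℕ), by positivity, (2 * D + L + 2) * (2 * D + L + 2) * N + 1,
    by positivity, fun x y hR hxy => ?_⟩
  obtain ⟨u, hu⟩ := exists_edist_ofVertex_le_one x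
  obtain ⟨v, hv⟩ := exists_edist_ofVertex_le_one y
  have huv : EDist.edist (ofVertex (graph A B) u) (ofVertex (graph A B) v) < ⊤ := by
    refine lt_of_le_of_lt (edist_triangle4 _ x y _) ?_
    rw [edist_comm _ x]
    exact ENNReal.add_lt_top.mpr ⟨ENNReal.add_lt_top.mpr
      ⟨hu.trans_lt ENNReal.one_lt_top, hxy⟩, hv.trans_lt ENNReal.one_lt_top⟩
  obtain ⟨w, -⟩ := exists_walk_length_lt huv
  classical
  obtain ⟨p, hp⟩ : ∃ p : (graph A B).Walk u v, p.IsPath := ⟨w.bypass, w.bypass_isPath⟩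
  have hlen : 3 * D + L + 3 < p.length := by
    have : EDist.edist x y ≤ 1 + p.length + 1 := by
      refine (edist_triangle4 _ (ofVertex (graph A B) u) (ofVertex (graph A B) v) _).trans ?_
      rw [edist_comm _ y]
      gcongr
      exact edist_ofVertex_le_length p
    have h3 : ((3 * D + L + 5 : ℕ) : ENNReal) < (1 + p.length + 1 : ℕ) := by
      push_cast at hR ⊢
      exact hR.trans_le this
    have h4 := Nat.cast_lt.mp h3
    omega
  -- two vertices in the interior of the geodesic, at distance `L` from each other
  let i := D + 1
  let i' := D + 1 + L
  have hstab : {g : G | g • p.getVert i = p.getVert i ∧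
      g • p.getVert i' = p.getVert i'}.encard ≤ N := by
    have hd := (hp.drop i).take L
    refine h _ _ (((p.drop i).take L).copy rfl (p.drop_getVert i L)) (by simpa using hd) ?_
    rw [Walk.length_copy, Walk.take_length, Walk.drop_length]
    omega
  let K := Finset.range (2 * D + L + 2)
  let S : ℕ × ℕ → Set G := fun j =>
    {g | g • p.getVert j.1 = p.getVert i ∧ g • p.getVert j.2 = p.getVert i'}
  have hS : ∀ j, (S j).encard ≤ N := by
    intro j
    rcases (S j).eq_empty_or_nonempty with he | ⟨g₀, hg₀⟩
    · simp [he]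
    · -- `S j` is a coset of the stabilizer of the two vertices
      refine le_trans (Set.encard_le_encard_of_injOn (f := fun g => g * g₀⁻¹) ?_ ?_) hstab
      · rintro g hg
        refine ⟨?_, ?_⟩
        · change (g * g₀⁻¹) • _ = _
          nth_rw 1 [← hg₀.1]
          rw [mul_smul, inv_smul_smul, hg.1]
        · change (g * g₀⁻¹) • _ = _
          nth_rw 1 [← hg₀.2]
          rw [mul_smul, inv_smul_smul, hg.2]
      · exact fun _ _ _ _ e => mul_right_cancel e
  have hcover : {g : G | EDist.edist x (g • x) ≤ d ∧ EDist.edist y (g • y) ≤ d} ⊆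
      ⋃ j ∈ K ×ˢ K, S j := by
    rintro g ⟨hgx, hgy⟩
    obtain ⟨q, hq⟩ := hw hu hgx
    obtain ⟨r, hr⟩ := hw hv hgy
    obtain ⟨j, hj, e⟩ := exists_smul_getVert_eq hΓ hp (i := i) (by omega) (by omega) q hq r hr
    obtain ⟨j', hj', e'⟩ := exists_smul_getVert_eq hΓ hp (i := i') (by omega) (by omega) q hq r hr
    simp only [Set.mem_iUnion]
    refine ⟨(j, j'), ?_, e, e'⟩
    simp only [K, Finset.mem_product, Finset.mem_range]
    omega
  calc _ ≤ (⋃ j ∈ K ×ˢ K, S j).encard := Set.encard_le_encard hcover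
    _ ≤ ∑ j ∈ K ×ˢ K, (S j).encard := Finset.set_encard_biUnion_le _ _
    _ ≤ ∑ j ∈ K ×ˢ K, (N : ENat) := Finset.sum_le_sum fun j _ => hS j
    _ = ((2 * D + L + 2) * (2 * D + L + 2) * N : ℕ) := by
      simp [K]
    _ ≤ _ := by exact_mod_cast Nat.le_succ _

end BassSerre

/-! ### Adjacency in the Bass–Serre graph -/

namespace BassSerre

variable {G : Type*} [Group G] {A B : Subgroup G}

theorem graph_adj_inl_iff {f : G} {v : (G ⧸ A) ⊕ (G ⧸ B)} :
    (graph A B).Adj (Sum.inl (f : G ⧸ A)) v ↔ ∃ a ∈ A, v = Sum.inr ((f * a : G) : G ⧸ B) := by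
  simp only [graph, SimpleGraph.fromRel_adj]
  constructor
  · rintro ⟨-, ⟨f', h, rfl⟩ | ⟨f', -, h⟩⟩
    · refine ⟨f⁻¹ * f', QuotientGroup.eq.mp (Sum.inl_injective h), by simp⟩
    · simp at h
  · rintro ⟨a, ha, rfl⟩
    refine ⟨by simp, Or.inl ⟨f * a, ?_, rfl⟩⟩
    rw [Sum.inl.injEq, QuotientGroup.eq]
    simpa using ha

theorem graph_adj_inr_iff {f : G} {v : (G ⧸ A) ⊕ (G ⧸ B)} :
    (graph A B).Adj (Sum.inr (f : G ⧸ B)) v ↔ ∃ b ∈ B, v = Sum.inl ((f * b : G) : G ⧸ A) := by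
  simp only [graph, SimpleGraph.fromRel_adj]
  constructor
  · rintro ⟨-, ⟨f', h, -⟩ | ⟨f', rfl, h⟩⟩
    · simp at h
    · refine ⟨f⁻¹ * f', QuotientGroup.eq.mp (Sum.inr_injective h), by simp⟩
  · rintro ⟨b, hb, rfl⟩
    refine ⟨by simp, Or.inr ⟨f * b, rfl, ?_⟩⟩
    rw [Sum.inr.injEq, QuotientGroup.eq]
    simpa using hb

theorem smul_inl (g f : G) :
    g • (Sum.inl (f : G ⧸ A) : (G ⧸ A) ⊕ (G ⧸ B)) = Sum.inl ((g * f : G) : G ⧸ A) := rfl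

theorem smul_inr (g f : G) :
    g • (Sum.inr (f : G ⧸ B) : (G ⧸ A) ⊕ (G ⧸ B)) = Sum.inr ((g * f : G) : G ⧸ B) := rfl

theorem inl_eq_inl_iff {f f' : G} :
    (Sum.inl (f : G ⧸ A) : (G ⧸ A) ⊕ (G ⧸ B)) = Sum.inl (f' : G ⧸ A) ↔ f⁻¹ * f' ∈ A := by
  rw [Sum.inl.injEq, QuotientGroup.eq]

theorem inr_eq_inr_iff {f f' : G} :
    (Sum.inr (f : G ⧸ B) : (G ⧸ A) ⊕ (G ⧸ B)) = Sum.inr (f' : G ⧸ B) ↔ f⁻¹ * f' ∈ B := by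
  rw [Sum.inr.injEq, QuotientGroup.eq]

theorem exists_walk_smul (g : G) {u v u' v' : (G ⧸ A) ⊕ (G ⧸ B)} (p : (graph A B).Walk u v)
    (hu : g • u = u') (hv : g • v = v') :
    ∃ q : (graph A B).Walk u' v', q.length = p.length ∧ (p.IsPath → q.IsPath) ∧
      q.support = p.support.map (g • ·) ∧ q.edges = p.edges.map (Sym2.map (g • ·)) := by
  subst hu hv
  exact ⟨p.map (translate A B g), SimpleGraph.Walk.length_map _ _,
    fun h => h.map (translate_injective g), SimpleGraph.Walk.support_map _ _,
    SimpleGraph.Walk.edges_map _ _⟩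

end BassSerre

/-! ### Affine and elementary automorphisms of the plane -/

namespace PlaneAut

open Polynomial

variable {k : Type*} [Field k]

theorem isPolynomialMap_elementary (a b c : k) (P : k[X]) :
    IsPolynomialMap fun p : k × k => (a * p.1 + P.eval p.2, b * p.2 + c) := by
  refine ⟨MvPolynomial.C a * MvPolynomial.X 0 + aeval (MvPolynomial.X 1) P,
    MvPolynomial.C b * MvPolynomial.X 1 + MvPolynomial.C c, fun p => ?_⟩
  have h : MvPolynomial.eval ![p.1, p.2] (aeval (MvPolynomial.X 1) P) = P.eval p.2 := by
    rw [← MvPolynomial.coe_aeval_eq_eval, RingHom.coe_coe, ← aeval_algHom_apply,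
      MvPolynomial.aeval_X, coe_aeval_eq_eval]
    rfl
  simp [h]

/-- The elementary automorphism `(x, y) ↦ (a x + P(y), b y + c)`. -/
def elementary (a b : kˣ) (c : k) (P : k[X]) : PlaneAut k where
  val :=
    { toFun p := (a * p.1 + P.eval p.2, b * p.2 + c)
      invFun p := ((a⁻¹ : kˣ) * (p.1 - P.eval ((b⁻¹ : kˣ) * (p.2 - c))), (b⁻¹ : kˣ) * (p.2 - c))
      left_inv p := by simp
      right_inv p := by simp }
  property := by
    refine ⟨isPolynomialMap_elementary _ _ _ _, ?_⟩
    convert isPolynomialMap_elementary (a⁻¹ : kˣ).1 (b⁻¹ : kˣ).1 (-((b⁻¹ : kˣ) * c))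
      (-(C (a⁻¹ : kˣ).1 * P.comp (C (b⁻¹ : kˣ).1 * (X - C c)))) using 1
    funext p
    change ((a⁻¹ : kˣ) * (p.1 - P.eval ((b⁻¹ : kˣ) * (p.2 - c))), (b⁻¹ : kˣ) * (p.2 - c)) = _
    simp only [eval_neg, eval_mul, eval_C, eval_comp, eval_sub, eval_X, Prod.mk.injEq]
    constructor <;> ring

@[simp]
theorem elementary_apply (a b : kˣ) (c : k) (P : k[X]) (x y : k) :
    (elementary a b c P).1 (x, y) = (a * x + P.eval y, b * y + c) := rfl

/-- The transposition `(x, y) ↦ (y, x)` of the coordinates. -/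
def swap (k : Type*) [Field k] : PlaneAut k where
  val := Equiv.prodComm k k
  property := by
    have h : IsPolynomialMap (Prod.swap : k × k → k × k) :=
      ⟨MvPolynomial.X 1, MvPolynomial.X 0, fun p => by simp [Prod.swap]⟩
    exact ⟨h, h⟩

@[simp]
theorem swap_apply (x y : k) : (swap k).1 (x, y) = (y, x) := rfl

theorem swap_inv : (swap k)⁻¹ = swap k := rfl

@[simp]
theorem coe_mul_apply (f g : PlaneAut k) (p : k × k) : (f * g).1 p = f.1 (g.1 p) := rfl

theorem ext_iff {f g : PlaneAut k} : f = g ↔ ∀ x y, f.1 (x, y) = g.1 (x, y) :=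
  ⟨fun h _ _ => by rw [h], fun h => Subtype.ext (Equiv.ext fun p => h p.1 p.2)⟩

theorem mem_affineAut_iff {f : PlaneAut k} :
    f ∈ affineAut k ↔ ∃ a b c a' b' c' : k, ∀ x y,
      f.1 (x, y) = (a * x + b * y + c, a' * x + b' * y + c') := by
  constructor
  · rintro ⟨φ, hφ⟩
    refine ⟨(φ.linear (1, 0)).1, (φ.linear (0, 1)).1, (φ 0).1, (φ.linear (1, 0)).2,
      (φ.linear (0, 1)).2, (φ 0).2, fun x y => ?_⟩
    have h1 : φ (x, y) = φ.linear (x, y) + φ 0 := by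
      simpa using φ.map_vadd 0 (x, y)
    have h2 : φ.linear (x, y) = x • φ.linear (1, 0) + y • φ.linear (0, 1) := by
      rw [← map_smul, ← map_smul, ← map_add]
      simp
    rw [hφ]
    change φ (x, y) = _
    rw [h1, h2]
    ext <;> simp [mul_comm]
  · rintro ⟨a, b, c, a', b', c', h⟩
    let φ : (k × k) →ᵃ[k] (k × k) :=
      { toFun := f.1
        linear := (a • LinearMap.fst k k k + b • LinearMap.snd k k k).prod
          (a' • LinearMap.fst k k k + b' • LinearMap.snd k k k)
        map_vadd' := by
          rintro ⟨x, y⟩ ⟨x', y'⟩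
          simp only [vadd_eq_add, Prod.mk_add_mk, h]
          change _ = ((a * x' + b * y' : k), (a' * x' + b' * y' : k)) + _
          rw [Prod.mk_add_mk, Prod.mk.injEq]
          constructor <;> ring }
    exact ⟨AffineEquiv.ofBijective (φ := φ) f.1.bijective, Equiv.ext fun _ => rfl⟩

theorem swap_mem_affineAut : swap k ∈ affineAut k :=
  mem_affineAut_iff.mpr ⟨0, 1, 0, 1, 0, 0, fun x y => by simp⟩

theorem elementary_mem_elementaryAut (a b : kˣ) (c : k) (P : k[X]) :
    elementary a b c P ∈ elementaryAut k :=
  ⟨a, b, c, P, mul_ne_zero a.ne_zero b.ne_zero, fun _ _ => rfl⟩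

theorem mem_affineAut_of_natDegree_le_one {f : PlaneAut k} {a b c : k} {P : k[X]}
    (h : ∀ x y, f.1 (x, y) = (a * x + P.eval y, b * y + c)) (hP : P.natDegree ≤ 1) :
    f ∈ affineAut k := by
  refine mem_affineAut_iff.mpr ⟨a, P.coeff 1, P.coeff 0, 0, b, c, fun x y => ?_⟩
  rw [h, eq_X_add_C_of_natDegree_le_one hP]
  simp [add_assoc]

theorem exists_of_mem_elementaryAut_of_notMem_affineAut {f : PlaneAut k}
    (hB : f ∈ elementaryAut k) (hA : f ∉ affineAut k) :
    ∃ (a b c : k) (P : k[X]), a ≠ 0 ∧ b ≠ 0 ∧ 2 ≤ P.natDegree ∧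
      ∀ x y, f.1 (x, y) = (a * x + P.eval y, b * y + c) := by
  obtain ⟨a, b, c, P, hab, h⟩ := hB
  refine ⟨a, b, c, P, left_ne_zero_of_mul hab, right_ne_zero_of_mul hab, ?_, h⟩
  by_contra! hlt
  exact hA (mem_affineAut_of_natDegree_le_one h (by omega))

theorem mem_elementaryAut_of_affine {f : PlaneAut k} {a b c b' c' : k}
    (h : ∀ x y, f.1 (x, y) = (a * x + b * y + c, b' * y + c')) : f ∈ elementaryAut k := by
  have ha : a ≠ 0 := by
    rintro rfl
    have := f.1.injective ((h 0 0).trans (by simpa using (h 1 0).symm))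
    simp at this
  have hb' : b' ≠ 0 := by
    rintro rfl
    have := f.1.injective ((h 0 1).trans (by simpa [ha, mul_div_cancel₀] using (h (b / a) 0).symm))
    simp at this
  refine ⟨a, b', c', C b * X + C c, mul_ne_zero ha hb', fun x y => ?_⟩
  rw [h]
  simp [add_assoc]

theorem exists_of_mem_affineAut_of_notMem_elementaryAut {f : PlaneAut k}
    (hA : f ∈ affineAut k) (hB : f ∉ elementaryAut k) :
    ∃ a b c a' b' c' : k, a' ≠ 0 ∧
      ∀ x y, f.1 (x, y) = (a * x + b * y + c, a' * x + b' * y + c') := by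
  obtain ⟨a, b, c, a', b', c', h⟩ := mem_affineAut_iff.mp hA
  refine ⟨a, b, c, a', b', c', ?_, h⟩
  rintro rfl
  exact hB (mem_elementaryAut_of_affine (by simpa using h))

/-! ### Ping-pong on parametrized curves -/

/-- The parametrized curves `t ↦ (F(t), G(t))` with `deg G < deg F` and `deg F ≥ n`. -/
def xDominant (k : Type*) [Field k] (n : ℕ) : Set (k → k × k) :=
  {γ | ∃ F G : k[X], (∀ t, γ t = (F.eval t, G.eval t)) ∧ G.natDegree < F.natDegree ∧
    n ≤ F.natDegree}

/-- The nonconstant parametrized curves `t ↦ (F(t), G(t))` with `deg F ≤ deg G`. -/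
def yDominant (k : Type*) [Field k] : Set (k → k × k) :=
  {γ | ∃ F G : k[X], (∀ t, γ t = (F.eval t, G.eval t)) ∧ F.natDegree ≤ G.natDegree ∧
    0 < G.natDegree}

theorem xDominant_anti {m n : ℕ} (h : m ≤ n) : xDominant k n ⊆ xDominant k m := by
  rintro γ ⟨F, G, hγ, h1, h2⟩
  exact ⟨F, G, hγ, h1, h.trans h2⟩

theorem comp_mem_xDominant {f : PlaneAut k} (hB : f ∈ elementaryAut k) (hA : f ∉ affineAut k)
    {γ : k → k × k} (hγ : γ ∈ yDominant k) : f.1 ∘ γ ∈ xDominant k 2 := by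
  obtain ⟨a, b, c, P, ha, hb, hP, hf⟩ := exists_of_mem_elementaryAut_of_notMem_affineAut hB hA
  obtain ⟨F, G, hγ, hFG, hG⟩ := hγ
  have h1 : (P.comp G).natDegree = P.natDegree * G.natDegree := natDegree_comp
  have h2 : 2 * G.natDegree ≤ P.natDegree * G.natDegree := Nat.mul_le_mul_right _ hP
  have h3 : (C a * F).natDegree = F.natDegree := natDegree_C_mul ha
  have h4 : (C a * F + P.comp G).natDegree = P.natDegree * G.natDegree := by
    rw [natDegree_add_eq_right_of_natDegree_lt (by omega), h1]
  have h5 : (C b * G + C c).natDegree = G.natDegree := by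
    rw [natDegree_add_C, natDegree_C_mul hb]
  exact ⟨C a * F + P.comp G, C b * G + C c, fun t => by simp [hγ, hf], by omega, by omega⟩

theorem comp_mem_yDominant {f : PlaneAut k} (hA : f ∈ affineAut k) (hB : f ∉ elementaryAut k)
    {γ : k → k × k} (hγ : γ ∈ xDominant k 1) : f.1 ∘ γ ∈ yDominant k := by
  obtain ⟨a, b, c, a', b', c', ha', hf⟩ := exists_of_mem_affineAut_of_notMem_elementaryAut hA hB
  obtain ⟨F, G, hγ, hFG, -⟩ := hγ
  have h1 : (C a' * F + C b' * G + C c').natDegree = F.natDegree := by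
    rw [natDegree_add_C, natDegree_add_eq_left_of_natDegree_lt, natDegree_C_mul ha']
    rw [natDegree_C_mul ha']
    exact (natDegree_C_mul_le b' G).trans_lt hFG
  have h2 : (C a * F + C b * G + C c).natDegree ≤ F.natDegree := by
    rw [natDegree_add_C]
    exact natDegree_add_le_of_degree_le (natDegree_C_mul_le a F)
      ((natDegree_C_mul_le b G).trans hFG.le)
  exact ⟨C a * F + C b * G + C c, C a' * F + C b' * G + C c', fun t => by simp [hγ, hf],
    by omega, by omega⟩

theorem comp_notMem_xDominant [Infinite k] {f : PlaneAut k} (hA : f ∈ affineAut k) :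
    (fun t => f.1 (0, t)) ∉ xDominant k 2 := by
  rintro ⟨F, G, h, -, h2⟩
  obtain ⟨a, b, c, a', b', c', hf⟩ := mem_affineAut_iff.mp hA
  have hF : F = C b * X + C c := by
    refine Polynomial.funext fun t => ?_
    have := congrArg Prod.fst ((h t).symm.trans (hf 0 t))
    simpa using this
  have := natDegree_linear_le (a := b) (b := c)
  rw [← hF] at this
  omega

open BassSerre

/-- To detect on which side of the edge joining `A` to `B` a vertex lies, a vertex `f A` is probed
with the image of the `y`-axis under `f`, and a vertex `f B` with the image of the `x`-axis. This is
the set of vertices whose probe is, for some representative `f`, dominated by its first coordinate;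
it contains the half-tree on the side of `B`. The degree is required to be at least two for `f A`
because the vertex `A` has to be excluded, and affine images of the `y`-axis have degree one. -/
def elementarySide (k : Type*) [Field k] :
    Set ((PlaneAut k ⧸ affineAut k) ⊕ (PlaneAut k ⧸ elementaryAut k)) :=
  {v | (∃ f : PlaneAut k, v = Sum.inl ↑f ∧ (fun t => f.1 (0, t)) ∈ xDominant k 2) ∨
    ∃ f : PlaneAut k, v = Sum.inr ↑f ∧ (fun t => f.1 (t, 0)) ∈ xDominant k 1}

/-- The analogue of `elementarySide` for the half-tree on the side of `A`, whose vertices have a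
probe dominated by its second coordinate. -/
def affineSide (k : Type*) [Field k] :
    Set ((PlaneAut k ⧸ affineAut k) ⊕ (PlaneAut k ⧸ elementaryAut k)) :=
  {v | (∃ f : PlaneAut k, v = Sum.inl ↑f ∧ (fun t => f.1 (0, t)) ∈ yDominant k) ∨
    ∃ f : PlaneAut k, v = Sum.inr ↑f ∧ (fun t => f.1 (t, 0)) ∈ yDominant k}

theorem smul_mem_elementarySide {f : PlaneAut k} (hB : f ∈ elementaryAut k)
    (hA : f ∉ affineAut k) {v} (hv : v ∈ affineSide k) : f • v ∈ elementarySide k := by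
  rcases hv with ⟨g, rfl, hg⟩ | ⟨g, rfl, hg⟩
  · exact Or.inl ⟨f * g, rfl, comp_mem_xDominant hB hA hg⟩
  · exact Or.inr ⟨f * g, rfl, xDominant_anti one_le_two (comp_mem_xDominant hB hA hg)⟩

theorem smul_mem_affineSide {f : PlaneAut k} (hA : f ∈ affineAut k)
    (hB : f ∉ elementaryAut k) {v} (hv : v ∈ elementarySide k) : f • v ∈ affineSide k := by
  rcases hv with ⟨g, rfl, hg⟩ | ⟨g, rfl, hg⟩
  · exact Or.inl ⟨f * g, rfl, comp_mem_yDominant hA hB (xDominant_anti one_le_two hg)⟩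
  · exact Or.inr ⟨f * g, rfl, comp_mem_yDominant hA hB hg⟩

theorem inr_one_mem_elementarySide :
    Sum.inr ((1 : PlaneAut k) : PlaneAut k ⧸ elementaryAut k) ∈ elementarySide k :=
  Or.inr ⟨1, rfl, X, 0, fun t => by simp, by simp, by simp⟩

theorem inl_one_mem_affineSide :
    Sum.inl ((1 : PlaneAut k) : PlaneAut k ⧸ affineAut k) ∈ affineSide k :=
  Or.inl ⟨1, rfl, 0, X, fun t => by simp, by simp, by simp⟩

theorem inl_one_notMem_elementarySide [Infinite k] :
    Sum.inl ((1 : PlaneAut k) : PlaneAut k ⧸ affineAut k) ∉ elementarySide k := by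
  rintro (⟨f, h, hf⟩ | ⟨f, h, -⟩)
  · rw [inl_eq_inl_iff, inv_one, one_mul] at h
    exact comp_notMem_xDominant h hf
  · simp at h

/-- The ping-pong argument: a path issued from one of the ends of the base edge and avoiding this
edge stays on its side. -/
theorem mem_side_of_isPath (n : ℕ) :
    (∀ v (p : (graph (affineAut k) (elementaryAut k)).Walk
        (Sum.inr ((1 : PlaneAut k) : PlaneAut k ⧸ elementaryAut k)) v),
      p.length = n → p.IsPath → s(Sum.inr ↑(1 : PlaneAut k), Sum.inl ↑(1 : PlaneAut k)) ∉ p.edges →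
        v ∈ elementarySide k) ∧
    (∀ v (p : (graph (affineAut k) (elementaryAut k)).Walk
        (Sum.inl ((1 : PlaneAut k) : PlaneAut k ⧸ affineAut k)) v),
      p.length = n → p.IsPath → s(Sum.inl ↑(1 : PlaneAut k), Sum.inr ↑(1 : PlaneAut k)) ∉ p.edges →
        v ∈ affineSide k) := by
  induction n with
  | zero =>
    refine ⟨fun v p hl _ _ => ?_, fun v p hl _ _ => ?_⟩
    · rw [← p.eq_of_length_eq_zero hl]
      exact inr_one_mem_elementarySide
    · rw [← p.eq_of_length_eq_zero hl]
      exact inl_one_mem_affineSide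
  | succ n ih =>
    refine ⟨fun v p hl hp he => ?_, fun v p hl hp he => ?_⟩
    · cases p with
      | nil => simp at hl
      | @cons _ w _ h p =>
        obtain ⟨f, hB, hw⟩ := graph_adj_inr_iff.mp h
        rw [one_mul] at hw
        subst hw
        have hA : f ∉ affineAut k := by
          intro hA
          refine he ?_
          rw [show (Sum.inl ((1 : PlaneAut k) : PlaneAut k ⧸ affineAut k) : (PlaneAut k ⧸
            affineAut k) ⊕ (PlaneAut k ⧸ elementaryAut k)) = Sum.inl ↑f from
              inl_eq_inl_iff.mpr (by simpa using hA)]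
          simp
        rw [SimpleGraph.Walk.cons_isPath_iff] at hp
        have e : f⁻¹ • (Sum.inl ↑f : (PlaneAut k ⧸ affineAut k) ⊕ (PlaneAut k ⧸ elementaryAut k))
            = Sum.inl ↑(1 : PlaneAut k) := by
          rw [smul_inl, inv_mul_cancel]
        obtain ⟨q, hql, hqp, hqs, -⟩ := exists_walk_smul f⁻¹ p e rfl
        have := ih.2 (f⁻¹ • v) q (by simpa [hql] using hl) (hqp hp.1) ?_
        · simpa using smul_mem_elementarySide hB hA this
        · intro hmem
          have := SimpleGraph.Walk.snd_mem_support_of_mem_edges _ hmem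
          rw [hqs, List.mem_map] at this
          obtain ⟨x, hx, hx'⟩ := this
          refine hp.2 ?_
          rw [inv_smul_eq_iff, smul_inr] at hx'
          rwa [hx', show (Sum.inr ((f * 1 : PlaneAut k) : PlaneAut k ⧸ elementaryAut k) :
            (PlaneAut k ⧸ affineAut k) ⊕ (PlaneAut k ⧸ elementaryAut k)) = Sum.inr ↑(1 : PlaneAut k)
              from inr_eq_inr_iff.mpr (by simpa using hB)] at hx
    · cases p with
      | nil => simp at hl
      | @cons _ w _ h p =>
        obtain ⟨f, hA, hw⟩ := graph_adj_inl_iff.mp h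
        rw [one_mul] at hw
        subst hw
        have hB : f ∉ elementaryAut k := by
          intro hB
          refine he ?_
          rw [show (Sum.inr ((1 : PlaneAut k) : PlaneAut k ⧸ elementaryAut k) : (PlaneAut k ⧸
            affineAut k) ⊕ (PlaneAut k ⧸ elementaryAut k)) = Sum.inr ↑f from
              inr_eq_inr_iff.mpr (by simpa using hB)]
          simp
        rw [SimpleGraph.Walk.cons_isPath_iff] at hp
        have e : f⁻¹ • (Sum.inr ↑f : (PlaneAut k ⧸ affineAut k) ⊕ (PlaneAut k ⧸ elementaryAut k))
            = Sum.inr ↑(1 : PlaneAut k) := by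
          rw [smul_inr, inv_mul_cancel]
        obtain ⟨q, hql, hqp, hqs, -⟩ := exists_walk_smul f⁻¹ p e rfl
        have := ih.1 (f⁻¹ • v) q (by simpa [hql] using hl) (hqp hp.1) ?_
        · simpa using smul_mem_affineSide hA hB this
        · intro hmem
          have := SimpleGraph.Walk.snd_mem_support_of_mem_edges _ hmem
          rw [hqs, List.mem_map] at this
          obtain ⟨x, hx, hx'⟩ := this
          refine hp.2 ?_
          rw [inv_smul_eq_iff, smul_inl] at hx'
          rwa [hx', show (Sum.inl ((f * 1 : PlaneAut k) : PlaneAut k ⧸ affineAut k) :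
            (PlaneAut k ⧸ affineAut k) ⊕ (PlaneAut k ⧸ elementaryAut k)) = Sum.inl ↑(1 : PlaneAut k)
              from inl_eq_inl_iff.mpr (by simpa using hA)] at hx

theorem isAcyclic_graph [Infinite k] : (graph (affineAut k) (elementaryAut k)).IsAcyclic := by
  classical
  have key : ∀ f : PlaneAut k, (graph (affineAut k) (elementaryAut k)).IsBridge
      s(Sum.inr ↑f, Sum.inl ↑f) := by
    intro f
    rw [SimpleGraph.isBridge_iff_forall_walk_mem_edges]
    intro p
    by_contra hp
    have e1 : f⁻¹ • (Sum.inr ↑f : (PlaneAut k ⧸ affineAut k) ⊕ (PlaneAut k ⧸ elementaryAut k))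
        = Sum.inr ↑(1 : PlaneAut k) := by
      rw [smul_inr, inv_mul_cancel]
    have e2 : f⁻¹ • (Sum.inl ↑f : (PlaneAut k ⧸ affineAut k) ⊕ (PlaneAut k ⧸ elementaryAut k))
        = Sum.inl ↑(1 : PlaneAut k) := by
      rw [smul_inl, inv_mul_cancel]
    obtain ⟨q, -, hqp, -, hqe⟩ := exists_walk_smul f⁻¹ p.bypass e1 e2
    refine inl_one_notMem_elementarySide ((mem_side_of_isPath _).1 _ q rfl
      (hqp p.bypass_isPath) fun hmem => hp (p.edges_bypass_subset_edges ?_))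
    rwa [hqe, ← e1, ← e2, ← Sym2.map_mk,
      List.mem_map_of_injective (Sym2.map.injective (MulAction.injective f⁻¹))] at hmem
  rw [SimpleGraph.isAcyclic_iff_forall_adj_isBridge]
  intro v w h
  simp only [graph, SimpleGraph.fromRel_adj] at h
  obtain ⟨-, ⟨f, rfl, rfl⟩ | ⟨f, rfl, rfl⟩⟩ := h
  · rw [Sym2.eq_swap]
    exact key f
  · exact key f

end PlaneAut

/-! ### Fixed paths -/

namespace BassSerre

variable {G : Type*} [Group G] {A B : Subgroup G}

theorem exists_notMem_of_adj_inl {f : G} {v : (G ⧸ A) ⊕ (G ⧸ B)}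
    (h : (graph A B).Adj (Sum.inl (f : G ⧸ A)) v) (hne : v ≠ Sum.inr (f : G ⧸ B)) :
    ∃ a ∈ A, a ∉ B ∧ v = Sum.inr ((f * a : G) : G ⧸ B) := by
  obtain ⟨a, ha, rfl⟩ := graph_adj_inl_iff.mp h
  refine ⟨a, ha, fun hB => hne (inr_eq_inr_iff.mpr ?_), rfl⟩
  simpa using hB

theorem exists_notMem_of_adj_inr {f : G} {v : (G ⧸ A) ⊕ (G ⧸ B)}
    (h : (graph A B).Adj (Sum.inr (f : G ⧸ B)) v) (hne : v ≠ Sum.inl (f : G ⧸ A)) :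
    ∃ b ∈ B, b ∉ A ∧ v = Sum.inl ((f * b : G) : G ⧸ A) := by
  obtain ⟨b, hb, rfl⟩ := graph_adj_inr_iff.mp h
  refine ⟨b, hb, fun hA => hne (inl_eq_inl_iff.mpr ?_), rfl⟩
  simpa using hA

theorem smul_inl_eq_iff {g f : G} :
    g • (Sum.inl (f : G ⧸ A) : (G ⧸ A) ⊕ (G ⧸ B)) = Sum.inl (f : G ⧸ A) ↔ f⁻¹ * g * f ∈ A := by
  rw [eq_comm, smul_inl, inl_eq_inl_iff, mul_assoc]

theorem smul_inr_eq_iff {g f : G} :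
    g • (Sum.inr (f : G ⧸ B) : (G ⧸ A) ⊕ (G ⧸ B)) = Sum.inr (f : G ⧸ B) ↔ f⁻¹ * g * f ∈ B := by
  rw [eq_comm, smul_inr, inr_eq_inr_iff, mul_assoc]

/-- In a forest, an element fixing the ends of a path fixes its vertices. -/
theorem smul_eq_of_mem_support (hΓ : (graph A B).IsAcyclic) {u v : (G ⧸ A) ⊕ (G ⧸ B)}
    {p : (graph A B).Walk u v} (hp : p.IsPath) {g : G} (hu : g • u = u) (hv : g • v = v)
    {w : (G ⧸ A) ⊕ (G ⧸ B)} (hw : w ∈ p.support) : g • w = w := by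
  obtain ⟨q, -, hq, hs, -⟩ := exists_walk_smul g p hu hv
  have e : q = p := congrArg Subtype.val ((hΓ.subsingleton_path u v).elim ⟨q, hq hp⟩ ⟨p, hp⟩)
  rw [e] at hs
  have h : p.support.map id = p.support.map (g • ·) := by rwa [List.map_id]
  exact (List.map_inj_left.mp h w hw).symm

end BassSerre

/-! ### Leading coefficients under an affine substitution -/

namespace Polynomial

theorem coeff_comp_C_mul_X_add_C {R : Type*} [CommRing R] (P : R[X]) (δ h : R) (n : ℕ) :
    (P.comp (C δ * X + C h)).coeff n = (taylor h P).coeff n * δ ^ n := by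
  rw [← comp_C_mul_X_coeff, taylor_apply, comp_assoc]
  simp

theorem coeff_taylor_of_natDegree_eq_add_one {R : Type*} [CommRing R] {P : R[X]} {n : ℕ}
    (hP : P.natDegree = n + 1) (h : R) :
    (taylor h P).coeff n = P.coeff n + (n + 1) * P.coeff (n + 1) * h := by
  have hd : (hasseDeriv n P).natDegree < 2 := by
    have := natDegree_hasseDeriv_le P n
    omega
  rw [taylor_coeff, eval_eq_sum_range' hd, Finset.sum_range_succ, Finset.sum_range_one,
    hasseDeriv_coeff, hasseDeriv_coeff]
  simp [add_comm 1 n]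

/-- Comparison of the two leading coefficients in an identity `α P(y) = P(δ y + h) + e y + f`. -/
theorem eq_pow_and_eq_of_C_mul_eq_comp {k : Type*} [Field k] {P : k[X]} {m : ℕ}
    (hm : P.natDegree = m + 2) {α δ h e f : k}
    (H : C α * P = P.comp (C δ * X + C h) + C e * X + C f) :
    α = δ ^ (m + 2) ∧ (m + 2) * P.coeff (m + 2) * δ ^ (m + 1) * h =
      (α - δ ^ (m + 1)) * P.coeff (m + 1) - if m = 0 then e else 0 := by
  have hlc : P.coeff (m + 2) ≠ 0 := by
    rw [← hm]
    exact leadingCoeff_ne_zero.mpr fun h0 => by simp [h0] at hm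
  have h1 := congrArg (fun Q => coeff Q (m + 2)) H
  have h2 := congrArg (fun Q => coeff Q (m + 1)) H
  have ht : (taylor h P).coeff (m + 2) = P.coeff (m + 2) := by
    rw [← hm, coeff_taylor_natDegree, leadingCoeff]
  simp only [coeff_add, coeff_C_mul, coeff_comp_C_mul_X_add_C, ht,
    coeff_taylor_of_natDegree_eq_add_one hm, coeff_X, coeff_C] at h1 h2
  constructor
  · refine mul_right_cancel₀ hlc ?_
    simpa [mul_comm] using h1
  · by_cases h0 : m = 0
    · subst h0
      simp at h2 ⊢
      linear_combination -h2
    · simp [h0] at h2 ⊢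
      linear_combination -h2

end Polynomial

/-! ### Stabilizers of paths -/

namespace PlaneAut

open Polynomial BassSerre

variable {k : Type*} [Field k]

/-- A diagonal affine map `(x, y) ↦ (α x + β, δ y + c)` fixing a path which starts with the edge
from `A` to `B` and has two more edges satisfies `α = δ ^ m` for some `m ≥ 2` depending only on the
path, and its translation part `c` is a function of `α` and `δ`. -/
theorem exists_forall_eq_pow_of_conj_mem [CharZero k] {a b : PlaneAut k}
    (hbB : b ∈ elementaryAut k) (hbA : b ∉ affineAut k) (haA : a ∈ affineAut k)
    (haB : a ∉ elementaryAut k) :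
    ∃ m : ℕ, 2 ≤ m ∧ ∃ φ : k → k → k, ∀ (g : PlaneAut k) (α β δ c : k),
      (∀ x y, g.1 (x, y) = (α * x + β, δ * y + c)) → b⁻¹ * g * b ∈ affineAut k →
        (b * a)⁻¹ * g * (b * a) ∈ elementaryAut k → α = δ ^ m ∧ c = φ α δ := by
  obtain ⟨a₀, b₀, c₀, P, ha₀, hb₀, hP, hb⟩ :=
    exists_of_mem_elementaryAut_of_notMem_affineAut hbB hbA
  obtain ⟨u, u₂, u₃, v, v₂, v₃, hv, ha⟩ :=
    exists_of_mem_affineAut_of_notMem_elementaryAut haA haB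
  obtain ⟨m, hm⟩ := Nat.exists_eq_add_of_le' hP
  refine ⟨m + 2, by omega, fun α δ => b₀ * (((α - δ ^ (m + 1)) * P.coeff (m + 1) -
    if m = 0 then a₀ * ((δ - α) * u / v) else 0) / ((m + 2) * P.coeff (m + 2) * δ ^ (m + 1))) +
    c₀ - δ * c₀, fun g α β δ c hg hA hB => ?_⟩
  have hδ : δ ≠ 0 := by
    rintro rfl
    have := g.1.injective ((hg 0 0).trans (by simpa using (hg 0 1).symm))
    simp at this
  obtain ⟨h₁₁, h₁₂, h₁, h₂₁, h₂₂, h₂, hh⟩ := mem_affineAut_iff.mp hA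
  -- the identity `b h = g b`, where `h = b⁻¹ g b` is affine
  have key : ∀ x y, b.1 (h₁₁ * x + h₁₂ * y + h₁, h₂₁ * x + h₂₂ * y + h₂) = g.1 (b.1 (x, y)) := by
    intro x y
    rw [← hh, ← coe_mul_apply, ← coe_mul_apply]
    congr 2
    group
  simp only [hb, hg, Prod.mk.injEq] at key
  have e00 := (key 0 0).2
  have e10 := (key 1 0).2
  have e01 := (key 0 1).2
  have hh₂₁ : h₂₁ = 0 := mul_left_cancel₀ hb₀ (by linear_combination e10 - e00)
  have hh₂₂ : h₂₂ = δ := mul_left_cancel₀ hb₀ (by linear_combination e01 - e00)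
  subst hh₂₁ hh₂₂
  have e2 := (key 1 0).1
  have e3 := (key 0 0).1
  have hh₁₁ : h₁₁ = α := by
    simp only [mul_zero, mul_one, zero_add, add_zero] at e2 e3
    exact mul_left_cancel₀ ha₀ (by linear_combination e2 - e3)
  subst hh₁₁
  have hpoly : C h₁₁ * P = P.comp (C h₂₂ * X + C h₂) + C (a₀ * h₁₂) * X + C (a₀ * h₁ - β) := by
    refine Polynomial.funext fun y => ?_
    have := (key 0 y).1
    simp only [mul_zero, zero_add] at this
    simp only [eval_mul, eval_C, eval_add, eval_comp, eval_X]
    linear_combination -this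
  -- `h` preserves the direction of the image under `a` of the `x`-axis
  obtain ⟨a', b', c', P', -, hg'⟩ := hB
  have key' : ∀ x y, (b⁻¹ * g * b).1 (a.1 (x, y)) = a.1 (a' * x + P'.eval y, b' * y + c') := by
    intro x y
    rw [← hg', ← coe_mul_apply, ← coe_mul_apply]
    congr 2
    group
  simp only [ha, hh, Prod.mk.injEq] at key'
  have d1 := (key' 1 0).1
  have d2 := (key' 1 0).2
  have d3 := (key' 0 0).1
  have d4 := (key' 0 0).2
  have ha' : a' = h₂₂ := mul_right_cancel₀ hv (by linear_combination d4 - d2)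
  subst ha'
  have hh₁₂ : h₁₂ = (a' - h₁₁) * u / v := by
    rw [eq_div_iff hv]
    linear_combination d1 - d3
  obtain ⟨hα, hc⟩ := eq_pow_and_eq_of_C_mul_eq_comp hm hpoly
  refine ⟨hα, ?_⟩
  have hlc : P.coeff (m + 2) ≠ 0 := by
    rw [← hm]
    exact leadingCoeff_ne_zero.mpr fun h0 => by simp [h0] at hm
  have hm2 : (m + 2 : k) ≠ 0 := by exact_mod_cast (by omega : m + 2 ≠ 0)
  have hden : (m + 2) * P.coeff (m + 2) * a' ^ (m + 1) ≠ 0 :=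
    mul_ne_zero (mul_ne_zero hm2 hlc) (pow_ne_zero _ hδ)
  beta_reduce
  rw [← hh₁₂, ← hc, mul_div_cancel_left₀ _ hden]
  linear_combination -e00

/-- The decomposition of an affine map that is not elementary: `GL₂` is the union of the Borel
subgroup of upper triangular matrices and of its double coset containing the transposition. -/
theorem exists_swap_mul_mem_elementaryAut {a : PlaneAut k} (hA : a ∈ affineAut k)
    (hB : a ∉ elementaryAut k) :
    ∃ h ∈ affineAut k, h ∈ elementaryAut k ∧ (h * swap k)⁻¹ * a ∈ elementaryAut k := by
  obtain ⟨u, u₂, u₃, v, v₂, v₃, hv, ha⟩ :=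
    exists_of_mem_affineAut_of_notMem_elementaryAut hA hB
  have hh : elementary 1 (Units.mk0 v hv) 0 (C u * X) ∈ affineAut k :=
    mem_affineAut_iff.mpr ⟨1, u, 0, 0, v, 0, by simp⟩
  refine ⟨elementary 1 (Units.mk0 v hv) 0 (C u * X), hh,
    elementary_mem_elementaryAut _ _ _ _, ?_⟩
  have hr : (elementary 1 (Units.mk0 v hv) 0 (C u * X) * swap k)⁻¹ * a ∈ affineAut k :=
    mul_mem (inv_mem (mul_mem hh swap_mem_affineAut)) hA
  obtain ⟨a', b', c', a₂, b₂, c₂, hr⟩ := mem_affineAut_iff.mp hr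
  have key : ∀ x y, (elementary 1 (Units.mk0 v hv) 0 (C u * X) * swap k).1
      (a' * x + b' * y + c', a₂ * x + b₂ * y + c₂) = a.1 (x, y) := by
    intro x y
    rw [← hr, ← coe_mul_apply, mul_inv_cancel_left]
  simp [ha] at key
  have h00 := key 0 0
  have h10 := key 1 0
  simp only [mul_zero, mul_one, zero_add, add_zero] at h00 h10
  have ha' : a' = 1 := mul_left_cancel₀ hv (by linear_combination h10.2 - h00.2)
  have ha₂ : a₂ = 0 := by
    subst ha'
    linear_combination h10.1 - h00.1
  subst ha₂
  exact mem_elementaryAut_of_affine (by simpa using hr)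

theorem exists_eq_diagonal {g : PlaneAut k} (hA : g ∈ affineAut k) (hB : g ∈ elementaryAut k)
    (hs : (swap k)⁻¹ * g * swap k ∈ elementaryAut k) :
    ∃ α β δ c : k, ∀ x y, g.1 (x, y) = (α * x + β, δ * y + c) := by
  obtain ⟨a, b, c, a', b', c', h⟩ := mem_affineAut_iff.mp hA
  obtain ⟨p, q, r, P, -, hB⟩ := hB
  obtain ⟨p', q', r', P', -, hs⟩ := hs
  have hs' : ∀ x y, g.1 (y, x) = (q' * y + r', p' * x + P'.eval y) := by
    intro x y
    have : g.1 (y, x) = (swap k).1 (((swap k)⁻¹ * g * swap k).1 (x, y)) := by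
      rw [← coe_mul_apply, mul_assoc, mul_inv_cancel_left]
      rfl
    rw [this, hs, swap_apply]
  refine ⟨q', r', q, r, fun x y => Prod.ext ?_ ?_⟩
  · rw [hs']
  · rw [hB]

/-- When there are finitely many roots of unity, the pointwise stabilizers of the paths with six
edges centred at a coset of `A` have bounded order. -/
theorem encard_fixing_le [CharZero k] (hμ : {ζ : k | ∃ n : ℕ, 0 < n ∧ ζ ^ n = 1}.Finite)
    (w : ℕ → (PlaneAut k ⧸ affineAut k) ⊕ (PlaneAut k ⧸ elementaryAut k))
    (hadj : ∀ i < 6, (graph (affineAut k) (elementaryAut k)).Adj (w i) (w (i + 1)))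
    (hne : ∀ i < 5, w i ≠ w (i + 2)) {f₀ : PlaneAut k} (hf₀ : w 3 = Sum.inl ↑f₀) :
    {g : PlaneAut k | ∀ i ≤ 6, g • w i = w i}.encard ≤
      (({ζ : k | ∃ n : ℕ, 0 < n ∧ ζ ^ n = 1} ×ˢ
        {ζ : k | ∃ n : ℕ, 0 < n ∧ ζ ^ n = 1}).ncard : ℕ) := by
  -- choose a representative `f` of `w 3` with `w 4 = f B` and `w 2 = f s B`, `s` the transposition
  obtain ⟨f, h4, h3, h2, h3'⟩ : ∃ f : PlaneAut k, w 4 = Sum.inr ↑f ∧ w 3 = Sum.inl ↑f ∧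
      w 2 = Sum.inr ↑(f * swap k) ∧ w 3 = Sum.inl ↑(f * swap k) := by
    obtain ⟨a₁, ha₁, h4⟩ := graph_adj_inl_iff.mp (hf₀ ▸ hadj 3 (by norm_num))
    have h3 : w 3 = Sum.inl ↑(f₀ * a₁) := by
      rw [hf₀, inl_eq_inl_iff]
      simpa using ha₁
    obtain ⟨a, haA, haB, h2⟩ := exists_notMem_of_adj_inl (h3 ▸ (hadj 2 (by norm_num)).symm)
      (h4 ▸ hne 2 (by norm_num))
    obtain ⟨h, hhA, hhB, hr⟩ := exists_swap_mul_mem_elementaryAut haA haB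
    refine ⟨f₀ * a₁ * h, ?_, ?_, ?_, ?_⟩
    · rwa [h4, inr_eq_inr_iff, inv_mul_cancel_left]
    · rwa [h3, inl_eq_inl_iff, inv_mul_cancel_left]
    · rw [h2, eq_comm, inr_eq_inr_iff]
      simpa [mul_assoc] using hr
    · rw [h3, inl_eq_inl_iff]
      simpa [mul_assoc] using mul_mem hhA swap_mem_affineAut
  obtain ⟨b, hbB, hbA, h5⟩ := exists_notMem_of_adj_inr (h4 ▸ hadj 4 (by norm_num))
    (h3 ▸ (hne 3 (by norm_num)).symm)
  have h4' : w 4 = Sum.inr ↑(f * b) := by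
    rwa [h4, inr_eq_inr_iff, inv_mul_cancel_left]
  obtain ⟨a, haA, haB, h6⟩ := exists_notMem_of_adj_inl (h5 ▸ hadj 5 (by norm_num))
    (h4' ▸ (hne 4 (by norm_num)).symm)
  obtain ⟨b', hb'B, hb'A, h1⟩ := exists_notMem_of_adj_inr (h2 ▸ (hadj 1 (by norm_num)).symm)
    (h3' ▸ hne 1 (by norm_num))
  have h2' : w 2 = Sum.inr ↑(f * swap k * b') := by
    rwa [h2, inr_eq_inr_iff, inv_mul_cancel_left]
  obtain ⟨a', ha'A, ha'B, h0⟩ := exists_notMem_of_adj_inl (h1 ▸ (hadj 0 (by norm_num)).symm)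
    (h2' ▸ hne 0 (by norm_num))
  obtain ⟨m, hm, φ, hφ⟩ := exists_forall_eq_pow_of_conj_mem hbB hbA haA haB
  obtain ⟨m', hm', φ', hφ'⟩ := exists_forall_eq_pow_of_conj_mem hb'B hb'A ha'A ha'B
  have key : ∀ g : PlaneAut k, (∀ i ≤ 6, g • w i = w i) → ∃ α δ : k,
      (∃ n : ℕ, 0 < n ∧ α ^ n = 1) ∧ (∃ n : ℕ, 0 < n ∧ δ ^ n = 1) ∧
      ∀ x y, (f⁻¹ * g * f).1 (x, y) = (α * x + φ' δ α, δ * y + φ α δ) := by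
    intro g hg
    have f0 := hg 0 (by norm_num)
    have f1 := hg 1 (by norm_num)
    have f2 := hg 2 (by norm_num)
    have f3 := hg 3 (by norm_num)
    have f4 := hg 4 (by norm_num)
    have f5 := hg 5 (by norm_num)
    have f6 := hg 6 (by norm_num)
    rw [h0, smul_inr_eq_iff] at f0
    rw [h1, smul_inl_eq_iff] at f1
    rw [h2, smul_inr_eq_iff] at f2
    rw [h3, smul_inl_eq_iff] at f3
    rw [h4, smul_inr_eq_iff] at f4
    rw [h5, smul_inl_eq_iff] at f5
    rw [h6, smul_inr_eq_iff] at f6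
    obtain ⟨α, β, δ, c, hd⟩ := exists_eq_diagonal f3 f4 (by simpa [mul_assoc] using f2)
    obtain ⟨hα, hc⟩ := hφ _ α β δ c hd (by simpa [mul_assoc] using f5)
      (by simpa [mul_assoc] using f6)
    have hd' : ∀ x y, ((swap k)⁻¹ * (f⁻¹ * g * f) * swap k).1 (x, y) = (δ * x + c, α * y + β) := by
      intro x y
      rw [swap_inv, coe_mul_apply, coe_mul_apply, swap_apply, hd, swap_apply]
    obtain ⟨hδ, hβ⟩ := hφ' _ δ c α β hd' (by simpa [mul_assoc] using f1)
      (by simpa [mul_assoc] using f0)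
    have hα0 : α ≠ 0 := by
      rintro rfl
      have := (f⁻¹ * g * f).1.injective ((hd 0 0).trans (by simpa using (hd 1 0).symm))
      simp at this
    have hmm : m' * m = (m' * m - 1) + 1 :=
      (Nat.sub_add_cancel (Nat.mul_pos (by omega) (by omega))).symm
    have hpos : 0 < m' * m - 1 := by
      have := Nat.mul_le_mul hm' hm
      omega
    have hα1 : α ^ (m' * m - 1) = 1 := by
      refine mul_right_cancel₀ hα0 ?_
      rw [← pow_succ, ← hmm, pow_mul, ← hδ, ← hα, one_mul]
    refine ⟨α, δ, ⟨_, hpos, hα1⟩, ⟨_, hpos, ?_⟩, fun x y => ?_⟩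
    · rw [hδ, ← pow_mul, mul_comm, pow_mul, hα1, one_pow]
    · rw [hd, ← hβ, ← hc]
  choose! α δ hα hδ hd using key
  rw [(hμ.prod hμ).cast_ncard_eq]
  refine Set.encard_le_encard_of_injOn (f := fun g => (α g, δ g))
    (fun g hg => ⟨hα g hg, hδ g hg⟩) fun g hg g' hg' e => ?_
  rw [Prod.mk.injEq] at e
  have : f⁻¹ * g * f = f⁻¹ * g' * f := by
    rw [ext_iff]
    intro x y
    rw [hd g hg, hd g' hg', e.1, e.2]
  exact mul_left_cancel (mul_right_cancel this)

theorem isAcylindrical_of_finite [CharZero k]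
    (hμ : {ζ : k | ∃ n : ℕ, 0 < n ∧ ζ ^ n = 1}.Finite) :
    IsAcylindrical (PlaneAut k) (Tree (affineAut k) (elementaryAut k)) := by
  refine isAcylindrical_of_encard_stabilizer_le isAcyclic_graph 7
    ({ζ : k | ∃ n : ℕ, 0 < n ∧ ζ ^ n = 1} ×ˢ {ζ : k | ∃ n : ℕ, 0 < n ∧ ζ ^ n = 1}).ncard
    fun u v p hp hl => ?_
  have hadj : ∀ i < 7, (graph (affineAut k) (elementaryAut k)).Adj (p.getVert i)
      (p.getVert (i + 1)) := fun i hi => p.adj_getVert_succ (by omega)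
  -- one of the two middle vertices is a coset of `A`
  obtain ⟨i, hi, f, hf⟩ : ∃ i ≤ 1, ∃ f : PlaneAut k, p.getVert (i + 3) = Sum.inl ↑f := by
    have h3 := hadj 3 (by norm_num)
    rcases h : p.getVert 3 with v | v
    · obtain ⟨f, rfl⟩ := QuotientGroup.mk_surjective v
      exact ⟨0, by norm_num, f, h⟩
    · obtain ⟨f, rfl⟩ := QuotientGroup.mk_surjective v
      rw [h] at h3
      obtain ⟨b, -, h4⟩ := graph_adj_inr_iff.mp h3
      exact ⟨1, le_rfl, _, h4⟩
  refine le_trans (Set.encard_le_encard ?_) (encard_fixing_le hμ (fun j => p.getVert (i + j))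
    (fun j hj => hadj (i + j) (by omega)) (fun j hj e => ?_) hf)
  · rintro g ⟨hu, hv⟩ j -
    exact smul_eq_of_mem_support isAcyclic_graph hp hu hv (p.getVert_mem_support _)
  · have := hp.getVert_injOn (show i + j ≤ p.length by omega)
      (show i + (j + 2) ≤ p.length by omega) e
    omega

end PlaneAut

/-! ### Homotheties fixing the axis of a Hénon map -/

namespace PlaneAut

open Polynomial BassSerre SimpleGraph Realization

variable {k : Type*} [Field k]

/-- The Hénon map `(x, y) ↦ (y, x + y ^ (r + 1))`. -/
noncomputable def henon (k : Type*) [Field k] (r : ℕ) : PlaneAut k :=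
  swap k * elementary 1 1 0 (X ^ (r + 1))

/-- The homothety of ratio `ζ`. -/
noncomputable def homothety (ζ : kˣ) : PlaneAut k := elementary ζ ζ 0 0

theorem homothety_mem_affineAut (ζ : kˣ) : homothety ζ ∈ affineAut k :=
  mem_affineAut_iff.mpr ⟨ζ, 0, 0, 0, ζ, 0, fun x y => by simp [homothety]⟩

theorem homothety_injective : Function.Injective (homothety : kˣ → PlaneAut k) := by
  intro ζ ζ' h
  have := ext_iff.mp h 1 0
  simp only [homothety, elementary_apply, Prod.mk.injEq] at this
  exact Units.ext (by simpa using this.1)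

theorem commute_homothety_henon {ζ : kˣ} {r : ℕ} (h : ζ ^ r = 1) :
    Commute (homothety ζ) (henon k r) := by
  have h' : (ζ : k) ^ r = 1 := by
    rw [← Units.val_pow_eq_pow_val, h, Units.val_one]
  refine ext_iff.mpr fun x y => ?_
  simp only [homothety, henon, coe_mul_apply, elementary_apply, swap_apply]
  simp only [pow_succ, eval_mul, eval_pow, eval_X, eval_zero, Units.val_one,
    Prod.mk.injEq]
  constructor
  · ring
  · linear_combination (-(ζ * y * y ^ r)) * h'

theorem elementary_X_pow_notMem_affineAut [Infinite k] {r : ℕ} (hr : 0 < r) :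
    elementary 1 1 0 (X ^ (r + 1)) ∉ affineAut k := by
  intro h
  refine comp_notMem_xDominant h ⟨X ^ (r + 1), X, fun t => by simp, ?_, ?_⟩
  · rw [natDegree_X_pow, natDegree_X]
    omega
  · rw [natDegree_X_pow]
    omega

theorem swap_notMem_elementaryAut : swap k ∉ elementaryAut k := by
  rintro ⟨a, b, c, P, hab, h⟩
  have h0 := (Prod.ext_iff.mp (h 0 0)).2
  have h1 := (Prod.ext_iff.mp (h 1 0)).2
  simp only [swap_apply] at h0 h1
  exact zero_ne_one (h0.trans h1.symm)

/-- The vertices of the axis of the Hénon map, which translates it by two. -/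
noncomputable def henonAxis (k : Type*) [Field k] (r i : ℕ) :
    (PlaneAut k ⧸ affineAut k) ⊕ (PlaneAut k ⧸ elementaryAut k) :=
  if Even i then Sum.inl ↑(henon k r ^ (i / 2)) else Sum.inr ↑(henon k r ^ (i / 2) * swap k)

theorem henonAxis_two_mul (r i : ℕ) : henonAxis k r (2 * i) = Sum.inl ↑(henon k r ^ i) := by
  rw [henonAxis, if_pos (even_two_mul i), Nat.mul_div_cancel_left _ two_pos]

theorem henonAxis_two_mul_add_one (r i : ℕ) :
    henonAxis k r (2 * i + 1) = Sum.inr ↑(henon k r ^ i * swap k) := by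
  rw [henonAxis, if_neg (by simp), Nat.mul_add_div two_pos]
  simp

theorem exists_isPath_henonAxis [Infinite k] {r : ℕ} (hr : 0 < r) (n : ℕ) :
    ∃ p : (graph (affineAut k) (elementaryAut k)).Walk (henonAxis k r 0) (henonAxis k r n),
      p.IsPath ∧ p.length = n := by
  have he := elementary_X_pow_notMem_affineAut (k := k) hr
  have hB : elementary 1 1 0 (X ^ (r + 1)) ∈ elementaryAut k := elementary_mem_elementaryAut _ _ _ _
  refine isAcyclic_graph.exists_isPath_of_forall_ne _ (fun i => ?_) (fun i => ?_) n
  · obtain ⟨j, rfl | rfl⟩ := Nat.even_or_odd' i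
    · rw [henonAxis_two_mul, henonAxis_two_mul_add_one]
      exact graph_adj_inl_iff.mpr ⟨_, swap_mem_affineAut, rfl⟩
    · rw [henonAxis_two_mul_add_one, show 2 * j + 1 + 1 = 2 * (j + 1) by ring, henonAxis_two_mul]
      refine graph_adj_inr_iff.mpr ⟨_, hB, ?_⟩
      rw [pow_succ, henon, mul_assoc]
  · obtain ⟨j, rfl | rfl⟩ := Nat.even_or_odd' i
    · rw [show 2 * j + 2 = 2 * (j + 1) by ring, henonAxis_two_mul, henonAxis_two_mul, Ne,
        inl_eq_inl_iff, pow_succ, inv_mul_cancel_left, henon]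
      rwa [Subgroup.mul_mem_cancel_left _ swap_mem_affineAut]
    · rw [show 2 * j + 1 + 2 = 2 * (j + 1) + 1 by ring, henonAxis_two_mul_add_one,
        henonAxis_two_mul_add_one, Ne, inr_eq_inr_iff, pow_succ, mul_assoc, mul_inv_rev, mul_assoc,
        inv_mul_cancel_left, henon, mul_assoc, inv_mul_cancel_left,
        Subgroup.mul_mem_cancel_left _ hB]
      exact swap_notMem_elementaryAut

theorem homothety_smul_henonAxis {ζ : kˣ} {r : ℕ} (h : ζ ^ r = 1) (i : ℕ) :
    homothety ζ • henonAxis k r (2 * i) = henonAxis k r (2 * i) := by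
  rw [henonAxis_two_mul, smul_inl_eq_iff, mul_assoc,
    ((commute_homothety_henon h).pow_right i).eq, inv_mul_cancel_left]
  exact homothety_mem_affineAut ζ

/-- In an acylindrical action, the number of `r`-th roots of unity is bounded independently of `r`:
the corresponding homotheties fix pointwise arbitrarily long segments of the axis of a Hénon
map. -/
theorem exists_forall_encard_le_of_isAcylindrical [Infinite k]
    (h : IsAcylindrical (PlaneAut k) (Tree (affineAut k) (elementaryAut k))) :
    ∃ N : ℕ, ∀ r : ℕ, 0 < r → {ζ : kˣ | ζ ^ r = 1}.encard ≤ N := by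
  obtain ⟨R, -, N, -, hN⟩ := h 0
  refine ⟨N, fun r hr => ?_⟩
  obtain ⟨n, hn⟩ := exists_nat_gt R
  obtain ⟨p, hp, hl⟩ := exists_isPath_henonAxis (k := k) hr (2 * n)
  have hlow : (R : ENNReal) < EDist.edist (ofVertex (graph (affineAut k) (elementaryAut k))
      (henonAxis k r 0)) (ofVertex _ (henonAxis k r (2 * n))) := by
    by_contra! hle
    have hlt : (R : ENNReal) < (n : ℕ) := by exact_mod_cast hn
    obtain ⟨q, hq⟩ := exists_walk_length_lt (hle.trans_lt hlt)
    have h1 := isAcyclic_graph.length_le_of_isPath hp q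
    have h2 : q.length < n := by exact_mod_cast hq
    omega
  have hup := (edist_ofVertex_le_length p).trans_lt (ENNReal.natCast_lt_top _)
  refine le_trans (Set.encard_le_encard_of_injOn (f := homothety) (fun ζ hζ => ?_)
    homothety_injective.injOn) (hN _ _ hlow hup)
  have h0 := homothety_smul_henonAxis (k := k) hζ 0
  have h1 := homothety_smul_henonAxis (k := k) hζ n
  rw [mul_zero] at h0
  constructor
  · rw [smul_ofVertex, h0]
    simp
  · rw [smul_ofVertex, h1]
    simp

theorem finite_of_isAcylindrical [Infinite k]
    (h : IsAcylindrical (PlaneAut k) (Tree (affineAut k) (elementaryAut k))) :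
    {ζ : k | ∃ n : ℕ, 0 < n ∧ ζ ^ n = 1}.Finite := by
  obtain ⟨N, hN⟩ := exists_forall_encard_le_of_isAcylindrical h
  by_contra hinf
  obtain ⟨s, hs, hcard⟩ := Set.Infinite.exists_subset_card_eq hinf (N + 1)
  -- a common exponent of the elements of `s`
  have hfin : ∀ ζ ∈ s, 0 < orderOf ζ := fun ζ hζ =>
    orderOf_pos_iff.mpr (isOfFinOrder_iff_pow_eq_one.mpr (hs hζ))
  have hpow : ∀ ζ ∈ s, ζ ^ (∏ ζ ∈ s, orderOf ζ) = 1 := fun ζ hζ =>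
    orderOf_dvd_iff_pow_eq_one.mp (Finset.dvd_prod_of_mem _ hζ)
  have hpos := Finset.prod_pos hfin
  have h1 : (s : Set k).encard ≤ {ζ : kˣ | ζ ^ (∏ ζ ∈ s, orderOf ζ) = 1}.encard := by
    refine (Set.encard_le_encard ?_).trans (Set.encard_image_le Units.val _)
    intro ζ hζ
    have h0 : ζ ≠ 0 := by
      rintro rfl
      have := hpow 0 hζ
      rw [zero_pow hpos.ne'] at this
      exact zero_ne_one this
    refine ⟨Units.mk0 ζ h0, Units.ext ?_, rfl⟩
    simpa using hpow ζ hζ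
  have h2 := h1.trans (hN _ hpos)
  rw [Set.encard_coe_eq_coe_finsetCard, hcard] at h2
  have : N + 1 ≤ N := by exact_mod_cast h2
  omega

end PlaneAut

theorem mainTheorem4 (k : Type*) [Field k] [CharZero k] :
    IsAcylindrical (PlaneAut k) (BassSerre.Tree (affineAut k) (elementaryAut k)) ↔
      {ζ : k | ∃ n : ℕ, 0 < n ∧ ζ ^ n = 1}.Finite :=
  ⟨PlaneAut.finite_of_isAcylindrical, PlaneAut.isAcylindrical_of_finite⟩
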